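/- **Model.** A source stores an array $X\in\{0,1\}^n$. There are $k$ peers with distinct identities, $1\le k\le n$, $n\ge 2$. Computation is synchronous. In each round every peer generates private independent fair random bits, sends the source a set of queries (each an index $i\in\{1,\dots,n\}$), receives the replies $X_i$, and then broadcasts one message (a bit string, possibly empty), which is delivered to all peers with the identity of its sender; every peer, corrupt or not, sends the same message to all. The queries depend on what the peer knows about earlier rounds and on its new random bits; the message may also depend on the replies of the same round. After the last round each peer outputs an array of $n$ bits. The parameters $n,k,\beta$ are known to the peers. **Adversary.** Let $\beta\in[0,1)$ and $\gamma=1-\beta$. A dynamic Byzantine adversary, which knows $X$ and the protocol, chooses at the start of every round an arbitrary new set of at most $\beta k$ corrupt peers, depending on all random bits, replies and messages of the earlier rounds; a peer may be corrupt in one round and nonfaulty in the next. In a round in which it is corrupt, a peer broadcasts an arbitrary message, and its private record of its random bits and source replies of that round is arbitrary too; this behaviour may even depend on the random bits generated by all peers in that round. In a round in which it is not corrupt, a peer follows the protocol. Broadcast messages are always delivered and recorded. **Theorem.** For every $c>0$ there is a constant $C>0$, depending only on $c$, such that for all integers $n\ge 2$, $1\le k\le n$ and all $\beta\in[0,1)$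 there is a randomized protocol (depending on $n,k,\beta,c$ only) in the broadcast model such that, for every input $X$ and every dynamic Byzantine adversary as above: 1. in every execution the protocol terminates after at most $C\log^2 n$ rounds; 2. in every execution, each peer makes at most $C\,\frac{n}{\gamma k}\log^2 n$ queries in total over the rounds in which it is nonfaulty; 3. in every execution, each message sent by a peer in a round in which it is nonfaulty has at most $C\,\frac{n}{\gamma k}\log n$ bits; 4. with probability at least $1-n^{-c}$ over the random bits, Download is solved: every peer that is nonfaulty in the last round outputs $X$. -/

import Mathlib

namespace DataRetrieval

/-- The input array `X` of `n` bits held by the source. -/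
abbrev Input (n : ℕ) := Fin n → Bool

/-- The random bits generated by the `k` peers in one round, `b` bits per peer. -/
abbrev Coins (k b : ℕ) := Fin k → Fin b → Bool

/-- The record of one peer for one round: the random bits it generated, the replies of the source
(`none` at the indices that were not queried) and the bit string it broadcast (the empty string
stands for silence). -/
structure PeerRound (n b : ℕ) where
  coins : Fin b → Bool
  replies : Fin n → Option Bool
  message : List Bool

/-- A full history: one record per peer for every past round, in chronological order. -/
abbrev History (n k b : ℕ) := List (Fin k → PeerRound n b)

/-- What a peer knows about one past round: its own random bits, its own replies from the source,
and the messages received. Communication is by broadcast: there is one message per sender, the same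
for all receivers, and the identity of the sender is known. -/
structure LocalRound (n k b : ℕ) where
  coins : Fin b → Bool
  replies : Fin n → Option Bool
  received : Fin k → List Bool

/-- The local view of a peer: what it knows about all past rounds, in chronological order. -/
abbrev LocalView (n k b : ℕ) := List (LocalRound n k b)

/-- The part of the history that peer `v` sees. -/
def localView {n k b : ℕ} (v : Fin k) (h : History n k b) : LocalView n k b :=
  h.map fun r => ⟨(r v).coins, (r v).replies, fun w => (r w).message⟩

/-- A synchronous randomized protocol for `k` peers in the broadcast model with an `n`-bit source.
In each round a peer generates `coinBits` random bits, sends a set of queries, gets the replies, and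
then broadcasts a message. After the last round it outputs a bit array. Local computation is
free. -/
structure Protocol (n k : ℕ) where
  /-- number of rounds until termination -/
  rounds : ℕ
  /-- number of random bits a peer generates per round -/
  coinBits : ℕ
  /-- the indices to query, from the local view and the random bits of the current round -/
  query : Fin k → LocalView n k coinBits → (Fin coinBits → Bool) → Finset (Fin n)
  /-- the message to broadcast, which may also depend on the replies of the current round -/
  message : Fin k → LocalView n k coinBits → (Fin coinBits → Bool) → (Fin n → Option Bool) →
    List Bool
  /-- the output, from the local view after the last round -/
  output : Fin k → LocalView n k coinBits → Fin n → Bool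

/-- A dynamic Byzantine adversary. At the start of every round it chooses, from the whole past
(all random bits, replies and messages), an arbitrary new set of at most `β * k` corrupt peers.
The record of each peer that is corrupt in this round is then arbitrary: its message, and also what
the peer will later remember of its own random bits and replies of this round. The behaviour of
the corrupt peers may also depend on the random bits generated by all peers in this round. -/
structure Adversary (n k b : ℕ) (β : ℝ) where
  corrupt : History n k b → Finset (Fin k)
  corrupt_card_le : ∀ h, ((corrupt h).card : ℝ) ≤ β * k
  behave : History n k b → Coins k b → Fin k → PeerRound n b

namespace Protocol

variable {n k : ℕ} (P : Protocol n k)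

/-- The record of a peer `v` that obeys the protocol in a round, given the past `h` and its random
bits `c` for this round. -/
def honestRound (X : Input n) (h : History n k P.coinBits) (v : Fin k)
    (c : Fin P.coinBits → Bool) : PeerRound n P.coinBits :=
  let Q := P.query v (localView v h) c
  let replies : Fin n → Option Bool := fun i => if i ∈ Q then some (X i) else none
  ⟨c, replies, P.message v (localView v h) c replies⟩

variable {β : ℝ} (X : Input n) (A : Adversary n k P.coinBits β)

/-- The records of all peers for the round that follows the past `h`. -/
def nextRound (h : History n k P.coinBits) (c : Coins k P.coinBits) :
    Fin k → PeerRound n P.coinBits :=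
  fun v => if v ∈ A.corrupt h then A.behave h c v else P.honestRound X h v (c v)

/-- The history of the first `t` rounds of the execution with input `X`, adversary `A` and random
bits `ω`. -/
def history (ω : Fin P.rounds → Coins k P.coinBits) :
    (t : ℕ) → t ≤ P.rounds → History n k P.coinBits
  | 0, _ => []
  | t + 1, ht =>
    let past := history ω t (Nat.le_of_succ_le ht)
    past ++ [P.nextRound X A past (ω ⟨t, ht⟩)]

/-- The history of the rounds before round `t`. -/
def pastOf (ω : Fin P.rounds → Coins k P.coinBits) (t : Fin P.rounds) :
    History n k P.coinBits :=
  P.history X A ω t t.isLt.le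

/-- Peer `v` is nonfaulty in round `t`. -/
def Nonfaulty (ω : Fin P.rounds → Coins k P.coinBits) (t : Fin P.rounds) (v : Fin k) : Prop :=
  v ∉ A.corrupt (P.pastOf X A ω t)

open scoped Classical in
/-- The number of queries that peer `v` makes in the execution, in those rounds in which it is
nonfaulty. -/
noncomputable def queryCost (ω : Fin P.rounds → Coins k P.coinBits) (v : Fin k) : ℕ :=
  ∑ t : Fin P.rounds, if P.Nonfaulty X A ω t v then
    (P.query v (localView v (P.pastOf X A ω t)) (ω t v)).card else 0

/-- The number of bits of the message that the protocol prescribes to peer `v` in round `t`. -/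
def messageSize (ω : Fin P.rounds → Coins k P.coinBits) (t : Fin P.rounds) (v : Fin k) : ℕ :=
  (P.honestRound X (P.pastOf X A ω t) v (ω t v)).message.length

/-- The execution solves Download: each peer that is nonfaulty in the last round (whether or not it
was corrupt before) outputs the whole input array. -/
def SolvesDownload (ω : Fin P.rounds → Coins k P.coinBits) : Prop :=
  ∀ v : Fin k, (∀ t : Fin P.rounds, (t : ℕ) + 1 = P.rounds → P.Nonfaulty X A ω t v) →
    P.output v (localView v (P.history X A ω P.rounds le_rfl)) = X

/-- The probability that Download is solved, where all random bits of all peers are independent and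
fair, that is, all choices of `ω` are equally likely. -/
noncomputable def successProb : ℝ :=
  (Nat.card {ω : Fin P.rounds → Coins k P.coinBits // P.SolvesDownload X A ω} : ℝ) /
    Nat.card (Fin P.rounds → Coins k P.coinBits)

end Protocol

end DataRetrieval

/-!
In every round the peers agree, from the broadcast messages, on a set of candidates for the input
and on a minimum set `S` of indices that separates them. `S` is dealt into `m` blocks; each peer
reads a random block and broadcasts what it reads, which is a vote for a pattern of bits on this
block. Candidates whose pattern on some block has fewer than about `γk/(2m)` votes are discarded.

A peer has one vote per round, so only `O(m/γ)` patterns survive, whatever the corrupt peers do.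
Candidates that agree on every block coincide, and `F` patterns on one block are separated by at
most `F` indices, so the next separating set has size `O(m/γ)`. With half as many blocks in the next
round a block again has `O(1/γ)` indices, except in the first round, where it has about `n/m`. When
one block is left, each peer reads all of `S` and knows which candidate is the input.

The input itself is discarded only if some block is read by too few nonfaulty peers. Since the
corrupt peers of a round are chosen before its random bits are drawn, a Chernoff bound for each
round and a union bound apply. They allow the first `m` to be of order `γk/log n`.
-/

namespace DataRetrieval

open Finset

section Separating

variable {ι α : Type*}

/-- A set of coordinates on which any two distinct members of `F` differ. -/
def IsSeparating (F : Finset (ι → α)) (S : Finset ι) : Prop :=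
  ∀ Y ∈ F, ∀ Z ∈ F, (∀ i ∈ S, Y i = Z i) → Y = Z

theorem IsSeparating.mono {F : Finset (ι → α)} {S T : Finset ι} (h : IsSeparating F S)
    (hST : S ⊆ T) : IsSeparating F T :=
  fun Y hY Z hZ hYZ => h Y hY Z hZ fun i hi => hYZ i (hST hi)

theorem IsSeparating.anti {F G : Finset (ι → α)} {S : Finset ι} (h : IsSeparating G S)
    (hFG : F ⊆ G) : IsSeparating F S :=
  fun Y hY Z hZ => h Y (hFG hY) Z (hFG hZ)

theorem IsSeparating.insert [DecidableEq (ι → α)] {F : Finset (ι → α)} {S : Finset ι}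
    (h : IsSeparating F S) {Y : ι → α} (hY : ∀ Z ∈ F, ∃ i ∈ S, Z i ≠ Y i) :
    IsSeparating (insert Y F) S := by
  intro Z hZ W hW hZW
  rcases mem_insert.mp hZ with rfl | hZF <;> rcases mem_insert.mp hW with rfl | hWF
  · rfl
  · obtain ⟨i, hi, hne⟩ := hY W hWF
    exact absurd (hZW i hi).symm hne
  · obtain ⟨i, hi, hne⟩ := hY Z hZF
    exact absurd (hZW i hi) hne
  · exact h Z hZF W hWF hZW

theorem exists_isSeparating_card_le (F : Finset (ι → α)) : ∃ S, IsSeparating F S ∧ #S ≤ #F := by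
  classical
  induction F using Finset.induction_on with
  | empty => exact ⟨∅, by simp [IsSeparating], le_rfl⟩
  | insert Y F hYF ih =>
    obtain ⟨S, hS, hcard⟩ := ih
    rw [card_insert_of_notMem hYF]
    by_cases hagree : ∃ Z ∈ F, ∀ i ∈ S, Z i = Y i
    · -- `Z` is the only such member of `F`, so one more coordinate suffices.
      obtain ⟨Z, hZ, hZY⟩ := hagree
      obtain ⟨i₀, hi₀⟩ := Function.ne_iff.mp (ne_of_mem_of_not_mem hZ hYF)
      refine ⟨insert i₀ S, (hS.mono (subset_insert _ _)).insert fun W hW => ?_,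
        (card_insert_le _ _).trans (by gcongr)⟩
      by_contra! hWY
      obtain rfl : W = Z := hS W hW Z hZ fun i hi =>
        (hWY i (mem_insert_of_mem hi)).trans (hZY i hi).symm
      exact hi₀ (hWY i₀ (mem_insert_self _ _))
    · push Not at hagree
      exact ⟨S, hS.insert hagree, hcard.trans (Nat.le_succ _)⟩

theorem exists_isSeparating_card_le_sum {κ : Type*} [DecidableEq ι] [DecidableEq α]
    {F : Finset (ι → α)} (J : Finset κ) (B : κ → Finset ι) (hF : IsSeparating F (J.biUnion B)) :
    ∃ S, IsSeparating F S ∧ #S ≤ ∑ j ∈ J, #(F.image (B j).restrict) := by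
  choose S hS hcard using fun j => exists_isSeparating_card_le (F.image (B j).restrict)
  refine ⟨J.biUnion fun j => (S j).map (Function.Embedding.subtype _), fun Y hY Z hZ hYZ => ?_,
    card_biUnion_le.trans (sum_le_sum fun j _ => (card_map _).trans_le (hcard j))⟩
  refine hF Y hY Z hZ fun i hi => ?_
  obtain ⟨j, hj, hij⟩ := mem_biUnion.mp hi
  have hrestrict : (B j).restrict Y = (B j).restrict Z :=
    hS j _ (mem_image_of_mem _ hY) _ (mem_image_of_mem _ hZ) fun x hx =>
      hYZ x (mem_biUnion.mpr ⟨j, hj, mem_map_of_mem (Function.Embedding.subtype _) hx⟩)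
  exact congrFun hrestrict ⟨i, hij⟩

/-- A separating set of `F` of least cardinality. All peers must agree on it, which is why it is
chosen as a function of `F`. -/
noncomputable def minSeparating (F : Finset (ι → α)) : Finset ι :=
  Function.argminOn card {S | IsSeparating F S}
    ((exists_isSeparating_card_le F).imp fun _ => And.left)

theorem isSeparating_minSeparating (F : Finset (ι → α)) : IsSeparating F (minSeparating F) :=
  Function.argminOn_mem card {S | IsSeparating F S} _

theorem card_minSeparating_le {F : Finset (ι → α)} {S : Finset ι} (h : IsSeparating F S) :
    #(minSeparating F) ≤ #S :=
  Function.argminOn_le card {S | IsSeparating F S} h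

end Separating

section Dealing

variable {ι : Type*} [DecidableEq ι]

/-- The number of the block that receives `i` when the elements of `S` are dealt out in turn to the
blocks `0, …, m - 1`. -/
noncomputable def deal (S : Finset ι) (m : ℕ) (i : ι) : ℕ := S.toList.idxOf i % m

/-- The `j`-th block when the elements of `S` are dealt out in turn to `m` blocks. -/
noncomputable def block (S : Finset ι) (m j : ℕ) : Finset ι := {i ∈ S | deal S m i = j}

theorem deal_lt (S : Finset ι) {m : ℕ} (hm : 0 < m) (i : ι) : deal S m i < m :=
  Nat.mod_lt _ hm

theorem biUnion_block (S : Finset ι) {m : ℕ} (hm : 0 < m) :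
    (range m).biUnion (block S m) = S :=
  biUnion_filter_eq_of_maps_to fun i _ => mem_range.mpr (deal_lt S hm i)

theorem block_one (S : Finset ι) : block S 1 0 = S :=
  filter_true_of_mem fun _ _ => Nat.mod_one _

theorem injOn_idxOf_toList (S : Finset ι) : Set.InjOn (S.toList.idxOf ·) (S : Set ι) :=
  fun _ hi _ _ h => (List.idxOf_inj (mem_toList.mpr hi)).mp h

theorem image_idxOf_toList (S : Finset ι) : S.image (S.toList.idxOf ·) = range #S := by
  refine eq_of_subset_of_card_le (image_subset_iff.mpr fun i hi => ?_) ?_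
  · rw [mem_range, ← length_toList, List.idxOf_lt_length_iff, mem_toList]
    exact hi
  · rw [card_range, card_image_of_injOn (injOn_idxOf_toList S)]

theorem card_block (S : Finset ι) {m j : ℕ} (hj : j < m) :
    #(block S m j) = Nat.count (· ≡ j [MOD m]) #S := by
  rw [Nat.count_eq_card_filter_range, ← image_idxOf_toList, filter_image,
    card_image_of_injOn ((injOn_idxOf_toList S).mono (filter_subset _ S))]
  refine congrArg card (filter_congr fun i _ => ?_)
  rw [deal, Nat.ModEq, Nat.mod_eq_of_lt hj]

theorem card_block_le (S : Finset ι) {m j : ℕ} (hj : j < m) :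
    (#(block S m j) : ℝ) ≤ #S / m + 1 := by
  have hcount : #(block S m j) ≤ #S / m + 1 := by
    rw [card_block S hj, Nat.count_modEq_card _ (j.zero_le.trans_lt hj)]
    gcongr
    split_ifs <;> omega
  calc (#(block S m j) : ℝ) ≤ ((#S / m : ℕ) : ℝ) + 1 := by exact_mod_cast hcount
    _ ≤ #S / m + 1 := by gcongr; exact Nat.cast_div_le

theorem card_block_mul (S : Finset ι) {m j : ℕ} (hm : m ∣ #S) (hj : j < m) :
    #(block S m j) * m = #S := by
  rw [card_block S hj, Nat.count_modEq_card _ (j.zero_le.trans_lt hj),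
    Nat.mod_eq_zero_of_dvd hm, if_neg (Nat.not_lt_zero _), add_zero, Nat.div_mul_cancel hm]

end Dealing

section Counting

theorem sum_pow_card_filter_mem {ι D R : Type*} [Fintype ι] [DecidableEq ι] [Fintype D]
    [DecidableEq D] [CommSemiring R] (H : Finset ι) (s : Finset D) (r : R) :
    ∑ x : ι → D, r ^ #{v ∈ H | x v ∈ s} = (#s * r + #sᶜ) ^ #H * Fintype.card D ^ #Hᶜ := by
  have hprod (x : ι → D) :
      r ^ #{v ∈ H | x v ∈ s} = ∏ v, if v ∈ H then (if x v ∈ s then r else 1) else 1 := by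
    rw [prod_ite_mem, univ_inter, prod_ite, prod_const, prod_const_one, mul_one]
  have hsum (v : ι) : (∑ d : D, if v ∈ H then (if d ∈ s then r else 1) else 1) =
      if v ∈ H then #s * r + #sᶜ else (Fintype.card D : R) := by
    split_ifs
    · simp [sum_ite, filter_not, ← compl_eq_univ_sdiff]
    · simp
  calc ∑ x : ι → D, r ^ #{v ∈ H | x v ∈ s}
      = ∏ v, ∑ d : D, if v ∈ H then (if d ∈ s then r else 1) else 1 := by
        simp only [hprod, prod_univ_sum, Fintype.piFinset_univ]
    _ = (#s * r + #sᶜ) ^ #H * Fintype.card D ^ #Hᶜ := by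
        simp only [hsum, prod_ite, prod_const, filter_not, filter_mem_eq_inter, univ_inter,
          ← compl_eq_univ_sdiff]

theorem sum_half_pow_card_filter_mem_le {ι D : Type*} [Fintype ι] [DecidableEq ι] [Fintype D]
    [DecidableEq D] [Nonempty D] (H : Finset ι) (s : Finset D) :
    ∑ x : ι → D, (1 / 2 : ℝ) ^ #{v ∈ H | x v ∈ s} ≤
      Real.exp (-(#H * (#s / Fintype.card D)) / 2) * Fintype.card (ι → D) := by
  have hN : (0 : ℝ) < Fintype.card D := by exact_mod_cast Fintype.card_pos
  have hsum : (#s : ℝ) + #sᶜ = Fintype.card D := by exact_mod_cast card_add_card_compl s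
  have hcard : (Fintype.card (ι → D) : ℝ) = Fintype.card D ^ Fintype.card ι := by
    rw [Fintype.card_fun, Nat.cast_pow]
  set N : ℝ := (Fintype.card D : ℝ)
  have hfactor : (#s * (1 / 2) + #sᶜ : ℝ) ≤ Real.exp (-(#s / N) / 2) * N :=
    calc (#s * (1 / 2) + #sᶜ : ℝ) = (-(#s / N) / 2 + 1) * N := by field_simp; linarith
      _ ≤ Real.exp (-(#s / N) / 2) * N := by gcongr; exact Real.add_one_le_exp _
  calc ∑ x : ι → D, (1 / 2 : ℝ) ^ #{v ∈ H | x v ∈ s}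
      = (#s * (1 / 2) + #sᶜ : ℝ) ^ #H * N ^ #Hᶜ := sum_pow_card_filter_mem H s _
    _ ≤ (Real.exp (-(#s / N) / 2) * N) ^ #H * N ^ #Hᶜ := by gcongr
    _ = Real.exp (-(#H * (#s / N)) / 2) * Fintype.card (ι → D) := by
        rw [mul_pow, ← Real.exp_nat_mul, mul_assoc, ← pow_add, card_add_card_compl,
          hcard]
        ring_nf

theorem card_filter_card_lt_le_exp_mul {ι D : Type*} [Fintype ι] [DecidableEq ι] [Fintype D]
    [DecidableEq D] [Nonempty D] (H : Finset ι) (s : Finset D) {τ : ℝ} (hτ : 0 ≤ τ)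
    (hmean : 2 * τ ≤ #H * (#s / Fintype.card D)) :
    (#{x : ι → D | (#{v ∈ H | x v ∈ s} : ℝ) < τ} : ℝ) ≤
      Real.exp (-τ / 4) * Fintype.card (ι → D) := by
  have hmarkov (x : ι → D) : (if (#{v ∈ H | x v ∈ s} : ℝ) < τ then 1 else 0 : ℝ) ≤
      2 ^ τ * (1 / 2) ^ #{v ∈ H | x v ∈ s} := by
    split_ifs with hx
    · rw [one_div, inv_pow, ← Real.rpow_natCast, ← Real.rpow_neg zero_le_two,
        ← Real.rpow_add zero_lt_two]
      exact Real.one_le_rpow one_le_two (by linarith)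
    · positivity
  calc (#{x : ι → D | (#{v ∈ H | x v ∈ s} : ℝ) < τ} : ℝ)
      = ∑ x : ι → D, if (#{v ∈ H | x v ∈ s} : ℝ) < τ then 1 else 0 := by rw [sum_boole]
    _ ≤ 2 ^ τ * ∑ x : ι → D, (1 / 2) ^ #{v ∈ H | x v ∈ s} := by
        rw [mul_sum]; exact sum_le_sum fun x _ => hmarkov x
    _ ≤ 2 ^ τ * (Real.exp (-τ) * Fintype.card (ι → D)) := by
        gcongr
        refine (sum_half_pow_card_filter_mem_le H s).trans ?_
        gcongr
        linarith
    _ = Real.exp (Real.log 2 * τ - τ) * Fintype.card (ι → D) := by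
        rw [Real.rpow_def_of_pos zero_lt_two, ← mul_assoc, ← Real.exp_add, sub_eq_add_neg]
    _ ≤ Real.exp (-τ / 4) * Fintype.card (ι → D) := by
        gcongr
        nlinarith [Real.log_two_lt_d9]

theorem card_filter_le_of_update {T : Type*} {E : T → Type*} [Fintype T] [DecidableEq T]
    [∀ t, Fintype (E t)] (t : T) [Nonempty (E t)] (Q : (∀ s, E s) → Prop) [DecidablePred Q] {ε : ℝ}
    (h : ∀ ω : ∀ s, E s, (#{x : E t | Q (Function.update ω t x)} : ℝ) ≤ ε * Fintype.card (E t)) :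
    (#{ω : ∀ s, E s | Q ω} : ℝ) ≤ ε * Fintype.card (∀ s, E s) := by
  let swap : (∀ s, E s) × E t → (∀ s, E s) × E t := fun p => (Function.update p.1 t p.2, p.1 t)
  -- Exchanging the coordinate `t` with a fresh one is an involution.
  have hswap : Function.Involutive swap := fun p => by simp [swap]
  have hE : (0 : ℝ) < Fintype.card (E t) := by exact_mod_cast Fintype.card_pos
  refine le_of_mul_le_mul_right ?_ hE
  calc (#{ω : ∀ s, E s | Q ω} : ℝ) * Fintype.card (E t)
      = ∑ p : (∀ s, E s) × E t, if Q p.1 then (1 : ℝ) else 0 := by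
        rw [Fintype.sum_prod_type_right]
        simp only [sum_boole, sum_const, card_univ, nsmul_eq_mul, mul_comm]
    _ = ∑ p : (∀ s, E s) × E t, if Q (Function.update p.1 t p.2) then (1 : ℝ) else 0 :=
        (Equiv.sum_comp hswap.toPerm fun p => if Q p.1 then (1 : ℝ) else 0).symm
    _ = ∑ ω : ∀ s, E s, (#{x : E t | Q (Function.update ω t x)} : ℝ) := by
        rw [Fintype.sum_prod_type]
        simp only [sum_boole]
    _ ≤ ∑ _ω : ∀ s, E s, ε * Fintype.card (E t) := sum_le_sum fun ω _ => h ω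
    _ = ε * Fintype.card (∀ s, E s) * Fintype.card (E t) := by
        rw [sum_const, card_univ, nsmul_eq_mul]; ring

end Counting

section Voting

variable {n k b : ℕ}

/-- The message of a peer with random bits `c` that has read the bits `p`. The random bits come
first, so that the receivers know which block was read. -/
noncomputable def announce {B : Type*} [Fintype B] (c : Fin b → Bool) (p : B → Bool) : List Bool :=
  List.ofFn c ++ univ.toList.map p

theorem length_announce {B : Type*} [Fintype B] (c : Fin b → Bool) (p : B → Bool) :
    (announce c p).length = b + Fintype.card B := by
  simp [announce]

theorem coins_eq_of_announce_eq {B B' : Type*} [Fintype B] [Fintype B'] {c c' : Fin b → Bool}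
    {p : B → Bool} {p' : B' → Bool} (h : announce c p = announce c' p') : c = c' :=
  List.ofFn_injective (List.append_inj_left h (by simp))

theorem announce_injective {B : Type*} [Fintype B] (c : Fin b → Bool) :
    Function.Injective (announce (B := B) c) :=
  fun _ _ h => funext fun i =>
    List.map_inj_left.mp (List.append_cancel_left h) i (mem_toList.mpr (mem_univ i))

/-- The message `msg` of a peer is a vote for `p`, a pair of a block number `j < m` and a pattern of
bits on the block `B j`. -/
def VotesFor (b m : ℕ) (B : ℕ → Finset (Fin n)) (msg : List Bool) (p : Σ j, B j → Bool) : Prop :=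
  ∃ c : Fin b → Bool, deal univ m c = p.1 ∧ msg = announce c p.2

theorem VotesFor.unique {m : ℕ} {B : ℕ → Finset (Fin n)} {msg : List Bool} {p q : Σ j, B j → Bool}
    (hp : VotesFor b m B msg p) (hq : VotesFor b m B msg q) : p = q := by
  obtain ⟨j, p⟩ := p
  obtain ⟨j', q⟩ := q
  obtain ⟨c, rfl, hp⟩ := hp
  obtain ⟨c', rfl, hq⟩ := hq
  obtain rfl := coins_eq_of_announce_eq (hp.symm.trans hq)
  exact congrArg (Sigma.mk _) (announce_injective c (hp.symm.trans hq))

open Classical in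
/-- The members of `F` whose restriction to each of `m` blocks of `minSeparating F` receives at
least `θ` votes. -/
noncomputable def survivors (b m : ℕ) (θ : ℝ) (F : Finset (Input n)) (msgs : Fin k → List Bool) :
    Finset (Input n) :=
  {Y ∈ F | ∀ j < m, θ ≤ #{v | VotesFor b m (block (minSeparating F) m) (msgs v)
    ⟨j, (block (minSeparating F) m j).restrict Y⟩}}

/-- Each peer votes at most once, and the patterns of the survivors on the blocks bound the size of
a separating set. -/
theorem card_minSeparating_survivors_mul_le {m : ℕ} (hm : 0 < m) {θ : ℝ} (hθ : 0 ≤ θ)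
    (F : Finset (Input n)) (msgs : Fin k → List Bool) :
    (#(minSeparating (survivors b m θ F msgs)) : ℝ) * θ ≤ k := by
  classical
  set F' := survivors b m θ F msgs
  let B : ℕ → Finset (Fin n) := block (minSeparating F) m
  let patterns : Finset (Σ j, B j → Bool) := (range m).sigma fun j => F'.image (B j).restrict
  have hsep : IsSeparating F' ((range m).biUnion B) := by
    rw [biUnion_block _ hm]
    exact (isSeparating_minSeparating F).anti (filter_subset _ _)
  obtain ⟨S, hS, hcard⟩ := exists_isSeparating_card_le_sum _ _ hsep
  have hpatterns : #(minSeparating F') ≤ #patterns :=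
    (card_minSeparating_le hS).trans (hcard.trans_eq (card_sigma _ _).symm)
  have hvotes : ∀ p ∈ patterns,
      θ ≤ #(univ.bipartiteAbove (fun p v => VotesFor b m B (msgs v) p) p) := by
    rintro ⟨j, p⟩ hp
    obtain ⟨hj, hpF'⟩ := mem_sigma.mp hp
    obtain ⟨Y, hY, rfl : (B j).restrict Y = p⟩ := mem_image.mp hpF'
    exact (mem_filter.mp hY).2 j (mem_range.mp hj)
  have hunique : ∀ v ∈ (univ : Finset (Fin k)),
      (#(patterns.bipartiteBelow (fun p v => VotesFor b m B (msgs v) p) v) : ℝ) ≤ 1 := by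
    intro v _
    refine Nat.cast_le_one.mpr (card_le_one.mpr fun p hp q hq => ?_)
    exact VotesFor.unique (mem_filter.mp hp).2 (mem_filter.mp hq).2
  calc (#(minSeparating F') : ℝ) * θ ≤ #patterns * θ := by gcongr
    _ ≤ k := by simpa using card_nsmul_le_card_nsmul _ hvotes hunique

/-- The inputs that are left after rounds with the messages `L`. The number of blocks is
`2 ^ (b - t)` in round `t`, and `τ / m` votes are needed when there are `m` blocks. -/
noncomputable def candidates (b : ℕ) (τ : ℝ) (L : List (Fin k → List Bool)) : Finset (Input n) :=
  L.reverseRecOn (motive := fun _ => Finset (Input n)) univ fun L msgs F =>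
    survivors b (2 ^ (b - L.length)) (τ / 2 ^ (b - L.length)) F msgs

theorem candidates_nil (τ : ℝ) :
    candidates b τ ([] : List (Fin k → List Bool)) = (univ : Finset (Input n)) := by
  rw [candidates, List.reverseRecOn_nil]

theorem candidates_concat (τ : ℝ) (L : List (Fin k → List Bool)) (msgs : Fin k → List Bool) :
    candidates (n := n) b τ (L ++ [msgs]) =
      survivors b (2 ^ (b - L.length)) (τ / 2 ^ (b - L.length)) (candidates b τ L) msgs := by
  rw [candidates, List.reverseRecOn_concat, candidates]

/-- The block that a peer with random bits `c` queries after rounds with the messages `L`. -/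
noncomputable def queryBlock (b : ℕ) (τ : ℝ) (L : List (Fin k → List Bool)) (c : Fin b → Bool) :
    Finset (Fin n) :=
  block (minSeparating (candidates b τ L)) (2 ^ (b - L.length)) (deal univ (2 ^ (b - L.length)) c)

theorem card_queryBlock_le (τ : ℝ) (L : List (Fin k → List Bool)) (c : Fin b → Bool) :
    (#(queryBlock (n := n) b τ L c) : ℝ) ≤
      #(minSeparating (candidates (n := n) b τ L)) / 2 ^ (b - L.length) + 1 := by
  exact_mod_cast card_block_le _ (deal_lt univ (Nat.two_pow_pos (b - L.length)) c)

theorem card_queryBlock_nil_le (τ : ℝ) (c : Fin b → Bool) :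
    (#(queryBlock (n := n) b τ ([] : List (Fin k → List Bool)) c) : ℝ) ≤ n / 2 ^ b + 1 := by
  refine (card_queryBlock_le τ [] c).trans ?_
  rw [List.length_nil, Nat.sub_zero]
  gcongr
  exact (card_le_univ _).trans_eq (Fintype.card_fin n)

theorem card_queryBlock_le_of_length_pos {τ : ℝ} (hτ : 0 < τ) {L : List (Fin k → List Bool)}
    (hL : 0 < L.length) (hLb : L.length ≤ b) (c : Fin b → Bool) :
    (#(queryBlock (n := n) b τ L c) : ℝ) ≤ 2 * k / τ + 1 := by
  obtain ⟨L', msgs, rfl⟩ := (List.eq_nil_or_concat' L).resolve_left (List.ne_nil_of_length_pos hL)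
  refine (card_queryBlock_le τ _ c).trans (add_le_add_left ?_ 1)
  rw [List.length_append, List.length_singleton] at hLb ⊢
  have hhalf : (2 : ℝ) ^ (b - L'.length) = 2 * 2 ^ (b - (L'.length + 1)) := by
    rw [← pow_succ', show b - (L'.length + 1) + 1 = b - L'.length by omega]
  have hvotes := card_minSeparating_survivors_mul_le (n := n) (b := b)
    (Nat.two_pow_pos (b - L'.length)) (θ := τ / 2 ^ (b - L'.length)) (by positivity)
    (candidates b τ L') msgs
  rw [← candidates_concat, hhalf, mul_div_assoc', div_le_iff₀ (by positivity)] at hvotes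
  rw [div_le_div_iff₀ (by positivity) hτ]
  linarith

theorem card_queryBlock_le_of_length_le {τ : ℝ} (hτ : 0 < τ) {L : List (Fin k → List Bool)}
    (hL : L.length ≤ b) (c : Fin b → Bool) :
    (#(queryBlock (n := n) b τ L c) : ℝ) ≤ n / 2 ^ b + 2 * k / τ + 1 := by
  rcases L.length.eq_zero_or_pos with hzero | hpos
  · obtain rfl := List.length_eq_zero_iff.mp hzero
    refine (card_queryBlock_nil_le τ c).trans ?_
    gcongr
    exact le_add_of_nonneg_right (by positivity)
  · refine (card_queryBlock_le_of_length_pos hτ hpos hL c).trans ?_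
    gcongr
    exact le_add_of_nonneg_left (by positivity)

end Voting

section Protocol

variable {n k b : ℕ}

/-- The messages of all peers in the rounds of a history. -/
def transcript (h : History n k b) : List (Fin k → List Bool) := h.map fun r w => (r w).message

theorem map_received_localView (v : Fin k) (h : History n k b) :
    (localView v h).map LocalRound.received = transcript h :=
  List.map_map

theorem localView_concat (v : Fin k) (h : History n k b) (r : Fin k → PeerRound n b) :
    localView v (h ++ [r]) =
      localView v h ++ [⟨(r v).coins, (r v).replies, fun w => (r w).message⟩] :=
  List.map_append

theorem length_transcript (h : History n k b) : (transcript h).length = h.length :=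
  List.length_map _

theorem transcript_concat (h : History n k b) (r : Fin k → PeerRound n b) :
    transcript (h ++ [r]) = transcript h ++ [fun w => (r w).message] :=
  List.map_append

namespace Protocol

variable (P : Protocol n k) {β : ℝ} (X : Input n) (A : Adversary n k P.coinBits β)

theorem length_history (ω : Fin P.rounds → Coins k P.coinBits) (t : ℕ) (ht : t ≤ P.rounds) :
    (P.history X A ω t ht).length = t := by
  induction t with
  | zero => rfl
  | succ t ih => rw [history, List.length_append, ih, List.length_singleton]

theorem length_pastOf (ω : Fin P.rounds → Coins k P.coinBits) (t : Fin P.rounds) :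
    (P.pastOf X A ω t).length = t :=
  P.length_history X A ω t _

theorem history_congr {ω ω' : Fin P.rounds → Coins k P.coinBits} (t : ℕ) (ht : t ≤ P.rounds)
    (h : ∀ s : Fin P.rounds, (s : ℕ) < t → ω s = ω' s) :
    P.history X A ω t ht = P.history X A ω' t ht := by
  induction t with
  | zero => rfl
  | succ t ih =>
    simp only [history]
    rw [ih (Nat.le_of_succ_le ht) fun s hs => h s (hs.trans t.lt_succ_self),
      h ⟨t, ht⟩ t.lt_succ_self]

theorem pastOf_update (ω : Fin P.rounds → Coins k P.coinBits) (t : Fin P.rounds)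
    (c : Coins k P.coinBits) : P.pastOf X A (Function.update ω t c) t = P.pastOf X A ω t :=
  P.history_congr X A _ _ fun _ hs => Function.update_of_ne (Fin.ne_of_lt hs) _ _

theorem nextRound_of_notMem {h : History n k P.coinBits} {v : Fin k} (hv : v ∉ A.corrupt h)
    (c : Coins k P.coinBits) : P.nextRound X A h c v = P.honestRound X h v (c v) :=
  if_neg hv

open Classical in
theorem card_filter_pastOf_le (t : Fin P.rounds)
    (Q : History n k P.coinBits → Coins k P.coinBits → Prop) {ε : ℝ}
    (hQ : ∀ h, (#{c | Q h c} : ℝ) ≤ ε * Fintype.card (Coins k P.coinBits)) :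
    (#{ω : Fin P.rounds → Coins k P.coinBits | Q (P.pastOf X A ω t) (ω t)} : ℝ) ≤
      ε * Fintype.card (Fin P.rounds → Coins k P.coinBits) := by
  refine card_filter_le_of_update t (fun ω => Q (P.pastOf X A ω t) (ω t)) fun ω => ?_
  simpa only [pastOf_update, Function.update_self] using hQ (P.pastOf X A ω t)

open Classical in
theorem one_sub_card_mul_le_successProb (T : Finset (Fin P.rounds))
    (bad : Fin P.rounds → History n k P.coinBits → Coins k P.coinBits → Prop) {ε : ℝ}
    (hbad : ∀ t ∈ T, ∀ h, (#{c | bad t h c} : ℝ) ≤ ε * Fintype.card (Coins k P.coinBits))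
    (hsolve : ∀ ω, (∀ t ∈ T, ¬ bad t (P.pastOf X A ω t) (ω t)) → P.SolvesDownload X A ω) :
    1 - #T * ε ≤ P.successProb X A := by
  have hpos : (0 : ℝ) < Fintype.card (Fin P.rounds → Coins k P.coinBits) := by
    exact_mod_cast Fintype.card_pos
  have hsub : ({ω | ¬ P.SolvesDownload X A ω} : Finset (Fin P.rounds → Coins k P.coinBits)) ⊆
      T.biUnion fun t => {ω | bad t (P.pastOf X A ω t) (ω t)} := by
    intro ω hω
    by_contra hgood
    refine (mem_filter.mp hω).2 (hsolve ω fun t ht hbad_t => hgood ?_)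
    exact mem_biUnion.mpr ⟨t, ht, mem_filter.mpr ⟨mem_univ ω, hbad_t⟩⟩
  have hfail : (#{ω | ¬ P.SolvesDownload X A ω} : ℝ) ≤
      #T * ε * Fintype.card (Fin P.rounds → Coins k P.coinBits) :=
    calc (#{ω | ¬ P.SolvesDownload X A ω} : ℝ)
        ≤ ∑ t ∈ T, (#{ω | bad t (P.pastOf X A ω t) (ω t)} : ℝ) := by
          exact_mod_cast (card_le_card hsub).trans card_biUnion_le
      _ ≤ ∑ _t ∈ T, ε * Fintype.card (Fin P.rounds → Coins k P.coinBits) :=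
          sum_le_sum fun t ht => P.card_filter_pastOf_le X A t (bad t) (hbad t ht)
      _ = #T * ε * Fintype.card (Fin P.rounds → Coins k P.coinBits) := by
          rw [sum_const, nsmul_eq_mul, mul_assoc]
  have hsplit : (#{ω | P.SolvesDownload X A ω} : ℝ) + #{ω | ¬ P.SolvesDownload X A ω} =
      Fintype.card (Fin P.rounds → Coins k P.coinBits) := by
    exact_mod_cast card_filter_add_card_filter_not _
  rw [successProb, Nat.card_eq_fintype_card, Nat.card_eq_fintype_card, Fintype.card_subtype,
    le_div_iff₀ hpos]
  linarith

end Protocol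

/-- The protocol in which each peer, in each of `b + 1` rounds, reads a random block of a minimum
separating set of the remaining candidates and broadcasts what it reads. In the last round, when
there is only one block, the replies single out one candidate. -/
noncomputable abbrev downloadProtocol (n k b : ℕ) (τ : ℝ) : Protocol n k where
  rounds := b + 1
  coinBits := b
  query _ l c := queryBlock b τ (l.map LocalRound.received) c
  message _ l c r :=
    announce c fun i : queryBlock b τ (l.map LocalRound.received) c => (r i.1).getD false
  output _ l := Classical.epsilon fun Y : Input n =>
    Y ∈ candidates b τ (l.dropLast.map LocalRound.received) ∧
      ∀ r ∈ l.getLast?, ∀ i x, r.replies i = some x → Y i = x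

variable {τ β : ℝ} (X : Input n)

theorem honestRound_message (h : History n k b) (v : Fin k) (c : Fin b → Bool) :
    ((downloadProtocol n k b τ).honestRound X h v c).message =
      announce c ((queryBlock b τ (transcript h) c).restrict X) := by
  rw [← map_received_localView v]
  exact congrArg (announce c) (funext fun i => congrArg (Option.getD · false) (if_pos i.2))

theorem honestRound_replies (h : History n k b) (v : Fin k) (c : Fin b → Bool) :
    ((downloadProtocol n k b τ).honestRound X h v c).replies =
      fun i => if i ∈ queryBlock b τ (transcript h) c then some (X i) else none := by
  rw [← map_received_localView v]
  rfl

theorem output_downloadProtocol_concat (v : Fin k) (l : LocalView n k b) (r : LocalRound n k b) :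
    (downloadProtocol n k b τ).output v (l ++ [r]) = Classical.epsilon fun Y : Input n =>
      Y ∈ candidates b τ (l.map LocalRound.received) ∧
        ∀ i x, r.replies i = some x → Y i = x := by
  simp only [List.dropLast_concat, List.getLast?_concat, Option.mem_some_iff, forall_eq']

section Cost

variable (A : Adversary n k b β)

theorem queryCost_downloadProtocol_le (hτ : 0 < τ)
    (ω : Fin (downloadProtocol n k b τ).rounds → Coins k b) (v : Fin k) :
    ((downloadProtocol n k b τ).queryCost X A ω v : ℝ) ≤
      n / 2 ^ b + 1 + b * (2 * k / τ + 1) := by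
  let P := downloadProtocol n k b τ
  let Q (t : Fin (b + 1)) : Finset (Fin n) :=
    queryBlock b τ (transcript (P.pastOf X A ω t)) (ω t v)
  have hcost : P.queryCost X A ω v ≤ ∑ t, #(Q t) := by
    refine sum_le_sum fun t _ => ?_
    split_ifs
    · exact (congrArg (fun L => #(queryBlock b τ L (ω t v))) (map_received_localView v _)).le
    · exact Nat.zero_le _
  have hlater (t : Fin b) : (#(Q t.succ) : ℝ) ≤ 2 * k / τ + 1 := by
    have hlength : (transcript (P.pastOf X A ω t.succ)).length = t + 1 :=
      (length_transcript _).trans (P.length_pastOf X A ω t.succ)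
    exact card_queryBlock_le_of_length_pos hτ (by omega) (by omega) _
  calc (P.queryCost X A ω v : ℝ) ≤ #(Q 0) + ∑ t : Fin b, (#(Q t.succ) : ℝ) := by
        rw [Fin.sum_univ_succ] at hcost
        exact_mod_cast hcost
    _ ≤ n / 2 ^ b + 1 + ∑ _t : Fin b, (2 * k / τ + 1) :=
        add_le_add (card_queryBlock_nil_le τ _) (sum_le_sum fun t _ => hlater t)
    _ = n / 2 ^ b + 1 + b * (2 * k / τ + 1) := by
        rw [sum_const, card_univ, Fintype.card_fin, nsmul_eq_mul]

theorem messageSize_downloadProtocol_le (hτ : 0 < τ)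
    (ω : Fin (downloadProtocol n k b τ).rounds → Coins k b)
    (t : Fin (downloadProtocol n k b τ).rounds) (v : Fin k) :
    ((downloadProtocol n k b τ).messageSize X A ω t v : ℝ) ≤
      b + (n / 2 ^ b + 2 * k / τ + 1) := by
  have hlength : (transcript ((downloadProtocol n k b τ).pastOf X A ω t)).length ≤ b :=
    ((length_transcript _).trans (Protocol.length_pastOf _ X A ω t)).trans_le
      (Nat.lt_succ_iff.mp t.isLt)
  rw [Protocol.messageSize, honestRound_message, length_announce, Fintype.card_coe, Nat.cast_add]
  gcongr
  exact card_queryBlock_le_of_length_le hτ hlength _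

end Cost

section Correctness

variable {A : Adversary n k b β}

theorem Adversary.le_card_compl_corrupt (A : Adversary n k b β) (h : History n k b) :
    (1 - β) * k ≤ #(A.corrupt h)ᶜ := by
  have hcard : (#(A.corrupt h) : ℝ) + #(A.corrupt h)ᶜ = k := by
    exact_mod_cast (card_add_card_compl _).trans (Fintype.card_fin k)
  linarith [A.corrupt_card_le h]

/-- For some block `j < m`, fewer than `τ / m` of the nonfaulty peers draw random bits `c` that make
them read the block `j`. -/
def Undersampled (A : Adversary n k b β) (τ : ℝ) (m : ℕ) (h : History n k b) (c : Coins k b) :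
    Prop :=
  ∃ j < m, (#{v ∈ (A.corrupt h)ᶜ | c v ∈ block univ m j} : ℝ) < τ / m

open Classical in
theorem card_undersampled_le (A : Adversary n k b β) (hτ : 0 ≤ τ) (hτβ : 2 * τ ≤ (1 - β) * k)
    {m : ℕ} (hm : m ∣ 2 ^ b) (h : History n k b) :
    (#{c | Undersampled A τ m h c} : ℝ) ≤
      m * Real.exp (-(τ / m) / 4) * Fintype.card (Coins k b) := by
  have hm_pos : (0 : ℝ) < m := by exact_mod_cast Nat.pos_of_dvd_of_pos hm (Nat.two_pow_pos b)
  have hcard : Fintype.card (Fin b → Bool) = 2 ^ b := by simp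
  have hblock {j : ℕ} (hj : j < m) :
      2 * (τ / m) ≤ #(A.corrupt h)ᶜ *
        (#(block (univ : Finset (Fin b → Bool)) m j) / Fintype.card (Fin b → Bool) : ℝ) := by
    have hdensity :
        (#(block (univ : Finset (Fin b → Bool)) m j) / Fintype.card (Fin b → Bool) : ℝ) =
          1 / m := by
      rw [div_eq_div_iff (by simp) hm_pos.ne', one_mul]
      exact_mod_cast card_block_mul univ (by rwa [card_univ, hcard]) hj
    rw [hdensity, mul_one_div, mul_div_assoc']
    gcongr
    exact hτβ.trans (A.le_card_compl_corrupt h)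
  have hsub : ({c | Undersampled A τ m h c} : Finset (Coins k b)) ⊆ (range m).biUnion fun j =>
      {c | (#{v ∈ (A.corrupt h)ᶜ | c v ∈ block univ m j} : ℝ) < τ / m} := by
    intro c hc
    obtain ⟨j, hj, hlt⟩ := (mem_filter.mp hc).2
    exact mem_biUnion.mpr ⟨j, mem_range.mpr hj, mem_filter.mpr ⟨mem_univ c, hlt⟩⟩
  calc (#{c | Undersampled A τ m h c} : ℝ)
      ≤ ∑ j ∈ range m, (#{c : Coins k b |
          (#{v ∈ (A.corrupt h)ᶜ | c v ∈ block univ m j} : ℝ) < τ / m} : ℝ) := by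
        exact_mod_cast (card_le_card hsub).trans card_biUnion_le
    _ ≤ ∑ _j ∈ range m, Real.exp (-(τ / m) / 4) * Fintype.card (Coins k b) :=
        sum_le_sum fun j hj => card_filter_card_lt_le_exp_mul _ _ (by positivity)
          (hblock (mem_range.mp hj))
    _ = m * Real.exp (-(τ / m) / 4) * Fintype.card (Coins k b) := by
        rw [sum_const, card_range, nsmul_eq_mul, mul_assoc]

theorem mem_candidates_concat_nextRound {h : History n k b} {c : Coins k b}
    (hX : X ∈ candidates b τ (transcript h))
    (hc : ¬ Undersampled A τ (2 ^ (b - h.length)) h c) :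
    X ∈ candidates b τ (transcript (h ++ [(downloadProtocol n k b τ).nextRound X A h c])) := by
  classical
  rw [transcript_concat, candidates_concat, length_transcript]
  refine mem_filter.mpr ⟨hX, fun j hj => ?_⟩
  have hvoters : τ / (2 ^ (b - h.length) : ℕ) ≤
      #{v ∈ (A.corrupt h)ᶜ | c v ∈ block univ (2 ^ (b - h.length)) j} :=
    not_lt.mp fun hlt => hc ⟨j, hj, hlt⟩
  rw [Nat.cast_pow, Nat.cast_ofNat] at hvoters
  refine hvoters.trans (Nat.cast_le.mpr (card_le_card fun v hv => ?_))
  obtain ⟨hnonfaulty, hblock⟩ := mem_filter.mp hv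
  obtain rfl : deal univ (2 ^ (b - h.length)) (c v) = j := (mem_filter.mp hblock).2
  refine mem_filter.mpr ⟨mem_univ v, c v, rfl, ?_⟩
  dsimp only
  rw [Protocol.nextRound_of_notMem _ _ _ (mem_compl.mp hnonfaulty), honestRound_message, queryBlock,
    length_transcript]

theorem output_downloadProtocol_eq {h : History n k b} (hlength : h.length = b)
    (hX : X ∈ candidates b τ (transcript h)) {v : Fin k} (hv : v ∉ A.corrupt h) (c : Coins k b) :
    (downloadProtocol n k b τ).output v
      (localView v (h ++ [(downloadProtocol n k b τ).nextRound X A h c])) = X := by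
  set F : Finset (Input n) := candidates b τ (transcript h)
  have hquery : queryBlock b τ (transcript h) (c v) = minSeparating F := by
    rw [queryBlock, length_transcript, hlength, Nat.sub_self, pow_zero, deal, Nat.mod_one,
      block_one]
  have hreplies (Y : Input n) :
      (∀ i x, ((downloadProtocol n k b τ).nextRound X A h c v).replies i = some x → Y i = x) ↔
        ∀ i ∈ minSeparating F, Y i = X i := by
    rw [Protocol.nextRound_of_notMem _ _ _ hv, honestRound_replies, hquery]
    simp [eq_comm]
  obtain ⟨hmem, hagree⟩ := Classical.epsilon_spec (p := fun Y : Input n =>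
    Y ∈ F ∧ ∀ i ∈ minSeparating F, Y i = X i) ⟨X, hX, fun _ _ => rfl⟩
  rw [localView_concat, output_downloadProtocol_concat, map_received_localView]
  simp only [hreplies]
  exact isSeparating_minSeparating F _ hmem _ hX hagree

theorem mem_candidates_history
    {ω : Fin (downloadProtocol n k b τ).rounds → Coins k b}
    (hgood : ∀ t : Fin (b + 1), (t : ℕ) < b →
      ¬ Undersampled A τ (2 ^ (b - t)) ((downloadProtocol n k b τ).pastOf X A ω t) (ω t))
    (t : ℕ) (ht : t ≤ b) :
    X ∈ candidates b τ
      (transcript ((downloadProtocol n k b τ).history X A ω t (Nat.le_succ_of_le ht))) := by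
  induction t with
  | zero =>
    change X ∈ candidates b τ []
    rw [candidates_nil]
    exact mem_univ X
  | succ t ih =>
    refine mem_candidates_concat_nextRound X (ih (Nat.le_of_succ_le ht)) ?_
    rw [Protocol.length_history]
    exact hgood ⟨t, _⟩ ht

theorem solvesDownload_downloadProtocol
    {ω : Fin (downloadProtocol n k b τ).rounds → Coins k b}
    (hgood : ∀ t : Fin (b + 1), (t : ℕ) < b →
      ¬ Undersampled A τ (2 ^ (b - t)) ((downloadProtocol n k b τ).pastOf X A ω t) (ω t)) :
    (downloadProtocol n k b τ).SolvesDownload X A ω := by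
  intro v hv
  have hlength := (downloadProtocol n k b τ).length_pastOf X A ω (Fin.last b)
  exact output_downloadProtocol_eq X hlength (mem_candidates_history X hgood b le_rfl)
    (hv (Fin.last b) rfl) (ω (Fin.last b))

open Classical in
theorem one_sub_le_successProb_downloadProtocol (A : Adversary n k b β) (hτ : 0 ≤ τ)
    (hτβ : 2 * τ ≤ (1 - β) * k) :
    1 - b * (2 ^ b * Real.exp (-(τ / 2 ^ b) / 4)) ≤
      (downloadProtocol n k b τ).successProb X A := by
  have hpow (t : ℕ) : (2 : ℝ) ^ (b - t) ≤ 2 ^ b :=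
    pow_le_pow_right₀ one_le_two (Nat.sub_le b t)
  have hbad (t : ℕ) (h : History n k b) : (#{c | Undersampled A τ (2 ^ (b - t)) h c} : ℝ) ≤
      2 ^ b * Real.exp (-(τ / 2 ^ b) / 4) * Fintype.card (Coins k b) := by
    refine (card_undersampled_le A hτ hτβ (pow_dvd_pow 2 (Nat.sub_le b t)) h).trans ?_
    rw [Nat.cast_pow, Nat.cast_ofNat]
    gcongr ?_ * Real.exp (-(τ / ?_) / 4) * _ <;> exact hpow t
  have hbound := (downloadProtocol n k b τ).one_sub_card_mul_le_successProb X A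
    ({t | (t : ℕ) < b} : Finset (Fin (b + 1))) (fun t => Undersampled A τ (2 ^ (b - t)))
    (fun t _ => hbad t)
    (fun ω hω => solvesDownload_downloadProtocol X fun t ht =>
      hω t (mem_filter.mpr ⟨mem_univ t, ht⟩))
  rwa [Fin.card_filter_val_lt, min_eq_right (Nat.le_succ b)] at hbound

end Correctness

end Protocol

section Parameters

theorem one_le_two_mul_log {n : ℕ} (hn : 2 ≤ n) : 1 ≤ 2 * Real.log n := by
  have hlog : Real.log 2 ≤ Real.log n := Real.log_le_log two_pos (by exact_mod_cast hn)
  linarith [Real.log_two_gt_d9]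

theorem exists_lt_two_pow_succ (q : ℝ) : ∃ b : ℕ, q < 2 ^ (b + 1) ∧ (b = 0 ∨ 2 ^ b ≤ q) := by
  rcases lt_or_ge q 1 with hq | hq
  · exact ⟨0, by norm_num; linarith, Or.inl rfl⟩
  · obtain ⟨b, hle, hlt⟩ := exists_nat_pow_near hq one_lt_two
    exact ⟨b, hlt, Or.inr hle⟩

theorem mul_two_pow_mul_exp_le {c x : ℝ} {n b : ℕ} (hn : 0 < n) (hbn : (2 : ℝ) ^ b ≤ n)
    (hx : 8 * (c + 2) * Real.log n ≤ x / 2 ^ b) :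
    b * (2 ^ b * Real.exp (-(x / 2 / 2 ^ b) / 4)) ≤ (n : ℝ) ^ (-c) := by
  have hn_pos : (0 : ℝ) < n := by exact_mod_cast hn
  have hb : (b : ℝ) ≤ 2 ^ b := by exact_mod_cast b.lt_two_pow_self.le
  have hexp : Real.exp (-(x / 2 / 2 ^ b) / 4) ≤ (n : ℝ) ^ (-(c + 2)) := by
    rw [Real.rpow_def_of_pos hn_pos, div_right_comm]
    gcongr
    linarith
  calc b * (2 ^ b * Real.exp (-(x / 2 / 2 ^ b) / 4))
      ≤ n * (n * (n : ℝ) ^ (-(c + 2))) := by gcongr; exact_mod_cast hb.trans hbn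
    _ = (n : ℝ) ^ (-c) := by
        rw [neg_add, Real.rpow_add hn_pos, Real.rpow_neg hn_pos.le 2, Real.rpow_two]
        field_simp

theorem exists_coinBits {c x : ℝ} {n : ℕ} (hc : 0 ≤ c) (hn : 2 ≤ n) (hx : 0 < x) (hxn : x ≤ n) :
    ∃ b : ℕ, (b : ℝ) ≤ 2 * Real.log n ∧
      n / 2 ^ b ≤ 16 * (c + 2) * (n / x) * Real.log n ∧
      b * (2 ^ b * Real.exp (-(x / 2 / 2 ^ b) / 4)) ≤ (n : ℝ) ^ (-c) := by
  have hlog := one_le_two_mul_log hn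
  have hn_two : (2 : ℝ) ≤ n := by exact_mod_cast hn
  have hscale : 1 ≤ 8 * (c + 2) * Real.log n := by nlinarith
  obtain ⟨b, hlt, hle⟩ := exists_lt_two_pow_succ (x / (8 * (c + 2) * Real.log n))
  have hbn : (2 : ℝ) ^ b ≤ n := by
    rcases hle with rfl | hle
    · linarith
    · exact (hle.trans (div_le_self hx.le hscale)).trans hxn
  refine ⟨b, ?_, ?_, ?_⟩
  · have hblog : b * Real.log 2 ≤ Real.log n := by
      rw [← Real.log_pow]
      exact Real.log_le_log (by positivity) hbn
    nlinarith [Real.log_two_gt_d9, b.cast_nonneg (α := ℝ)]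
  · rw [div_lt_iff₀ (by linarith), pow_succ] at hlt
    rw [div_le_iff₀ (by positivity)]
    calc (n : ℝ) = n / x * x := by field_simp
      _ ≤ n / x * (2 ^ b * 2 * (8 * (c + 2) * Real.log n)) := by gcongr
      _ = 16 * (c + 2) * (n / x) * Real.log n * 2 ^ b := by ring
  · rcases hle with rfl | hle
    · simpa using Real.rpow_nonneg n.cast_nonneg (-c)
    · refine mul_two_pow_mul_exp_le (by omega) hbn ?_
      rwa [le_div_comm₀ (by linarith) (by positivity)]

end Parameters

end DataRetrieval

theorem mainTheorem5_general (c : ℝ) (hc : 0 < c) :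
    ∃ C : ℝ, 0 < C ∧
      ∀ (n k : ℕ) (β : ℝ), 2 ≤ n → 1 ≤ k → k ≤ n → 0 ≤ β → β < 1 →
        ∃ P : DataRetrieval.Protocol n k,
          (P.rounds : ℝ) ≤ C * Real.log n ∧
          ∀ (X : DataRetrieval.Input n) (A : DataRetrieval.Adversary n k P.coinBits β),
            (∀ (ω : Fin P.rounds → DataRetrieval.Coins k P.coinBits) (v : Fin k),
              (P.queryCost X A ω v : ℝ) ≤ C * (n / ((1 - β) * k)) * Real.log n) ∧
            (∀ (ω : Fin P.rounds → DataRetrieval.Coins k P.coinBits) (t : Fin P.rounds)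
              (v : Fin k),
                (P.messageSize X A ω t v : ℝ) ≤ C * (n / ((1 - β) * k)) * Real.log n) ∧
            1 - (n : ℝ) ^ (-c) ≤ P.successProb X A := by
  refine ⟨16 * (c + 2) + 12, by positivity, fun n k β hn hk hkn hβ0 hβ1 => ?_⟩
  have hk_pos : (0 : ℝ) < k := by exact_mod_cast hk
  have hγk : 0 < (1 - β) * k := mul_pos (sub_pos.mpr hβ1) hk_pos
  have hk_le : (k : ℝ) ≤ n := by exact_mod_cast hkn
  have hγkn : (1 - β) * k ≤ n := (mul_le_of_le_one_left hk_pos.le (by linarith)).trans hk_le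
  have hlog := DataRetrieval.one_le_two_mul_log hn
  obtain ⟨b, hb, hfirst, hfail⟩ := DataRetrieval.exists_coinBits hc.le hn hγk hγkn
  set τ : ℝ := (1 - β) * k / 2 with hτ_def
  set R : ℝ := n / ((1 - β) * k)
  have hτ : 0 < τ := half_pos hγk
  have hR : 1 ≤ R := (one_le_div hγk).mpr hγkn
  have hlater : 2 * k / τ ≤ 4 * R := by
    have hRγk : R * ((1 - β) * k) = n := div_mul_cancel₀ _ hγk.ne'
    rw [div_le_iff₀ hτ, hτ_def]
    linarith
  refine ⟨DataRetrieval.downloadProtocol n k b τ, ?_, fun X A => ⟨fun ω v => ?_,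
    fun ω t v => ?_, ?_⟩⟩
  · push_cast
    nlinarith
  · refine (DataRetrieval.queryCost_downloadProtocol_le X A hτ ω v).trans ?_
    nlinarith
  · refine (DataRetrieval.messageSize_downloadProtocol_le X A hτ ω t v).trans ?_
    nlinarith
  · have hsucc := DataRetrieval.one_sub_le_successProb_downloadProtocol X A hτ.le (by linarith)
    linarith

theorem mainTheorem5 (c : ℝ) (hc : 0 < c) :
    ∃ C : ℝ, 0 < C ∧
      ∀ (n k : ℕ) (β : ℝ), 2 ≤ n → 1 ≤ k → k ≤ n → 0 ≤ β → β < 1 →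
        ∃ P : DataRetrieval.Protocol n k,
          (P.rounds : ℝ) ≤ C * Real.log n ^ 2 ∧
          ∀ (X : DataRetrieval.Input n) (A : DataRetrieval.Adversary n k P.coinBits β),
            (∀ (ω : Fin P.rounds → DataRetrieval.Coins k P.coinBits) (v : Fin k),
              (P.queryCost X A ω v : ℝ) ≤ C * (n / ((1 - β) * k)) * Real.log n ^ 2) ∧
            (∀ (ω : Fin P.rounds → DataRetrieval.Coins k P.coinBits) (t : Fin P.rounds)
              (v : Fin k), P.Nonfaulty X A ω t v →
                (P.messageSize X A ω t v : ℝ) ≤ C * (n / ((1 - β) * k)) * Real.log n) ∧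
            1 - (n : ℝ) ^ (-c) ≤ P.successProb X A := by
  obtain ⟨C, hC, hgeneral⟩ := mainTheorem5_general c hc
  refine ⟨2 * C, by positivity, fun n k β hn hk hkn hβ0 hβ1 => ?_⟩
  obtain ⟨P, hrounds, hP⟩ := hgeneral n k β hn hk hkn hβ0 hβ1
  have hlog := DataRetrieval.one_le_two_mul_log hn
  have hCL : C * Real.log n ≤ 2 * C * Real.log n ^ 2 := by nlinarith
  have hR : 0 ≤ n / ((1 - β) * k) :=
    div_nonneg n.cast_nonneg (mul_nonneg (sub_nonneg.mpr hβ1.le) k.cast_nonneg)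
  refine ⟨P, hrounds.trans hCL, fun X A => ⟨fun ω v => ((hP X A).1 ω v).trans ?_,
    fun ω t v _ => ((hP X A).2.1 ω t v).trans ?_, (hP X A).2.2⟩⟩
  · linarith [mul_le_mul_of_nonneg_left hCL hR]
  · gcongr
    linarith
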